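/- Let $m,n',n''$ be nonnegative integers with $(m,n',n'')\neq(0,0,1)$. Let $D(m,n'+n'')$ be the Cartesian product $\mathrm{Sh}^m\times K^{n'}\times K^{n''}$ on the vertex set $\mathbb{Z}_4^{2m}\times\mathbb{Z}_2^{2n'}\times\mathbb{Z}_4^{n''}=(\mathbb{Z}_4^2)^m\times(\mathbb{Z}_2^2)^{n'}\times\mathbb{Z}_4^{n''}$, where each $\mathbb{Z}_4^2$ carries the Shrikhande graph $\mathrm{Sh}$ (the Cayley graph of $\mathbb{Z}_4^2$ with generating set $\{(0,1),(3,0),(3,3),(0,3),(1,0),(1,1)\}$), and each $\mathbb{Z}_2^2$ and each $\mathbb{Z}_4$ carries the complete graph $K$ on its four elements (the Cayley graph with all nonzero elements as generators). An additive $1$-perfect code is a subgroup $C$ of $\mathbb{Z}_4^{2m}\times\mathbb{Z}_2^{2n'}\times\mathbb{Z}_4^{n''}$ that is an independent set of $D(m,n'+n'')$ and such that every vertex not in $C$ is adjacent to exactly one vertex of $C$. Then an additive $1$-perfect code in $\mathbb{Z}_4^{2m}\times\mathbb{Z}_2^{2n'}\times\mathbb{Z}_4^{n''}$ with the $D(m,n'+n'')$-metric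 exists if and only if there are nonnegative integers $\Gamma$ and $\Delta$ such that $$2m+n'+n''=\frac{2^{\Gamma+2\Delta}-1}{3},\qquad 3n'+n''=2^{\Gamma+\Delta}-1,\qquad n''\le 2^{\Delta}-1,\qquad n''\neq 1.$$ -/

import Mathlib

namespace Doob

/-- The Shrikhande graph `Sh`: the Cayley graph of the additive group `ℤ₄²` with the generating
set `{01, 30, 33, 03, 10, 11}`. -/
def shrikhande : SimpleGraph (ZMod 4 × ZMod 4) :=
  SimpleGraph.addCayley {(0, 1), (3, 0), (3, 3), (0, 3), (1, 0), (1, 1)}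

/-- The complete graph `K` on four vertices, as the Cayley graph of the additive group `ℤ₂²` with
the generating set `{01, 10, 11}`. -/
def completeZ2 : SimpleGraph (ZMod 2 × ZMod 2) :=
  SimpleGraph.addCayley {(0, 1), (1, 0), (1, 1)}

/-- The complete graph `K` on four vertices, as the Cayley graph of the additive group `ℤ₄` with
the generating set `{1, 2, 3}`. -/
def completeZ4 : SimpleGraph (ZMod 4) :=
  SimpleGraph.addCayley {1, 2, 3}

/-- The Cartesian power `G ^ k` of a graph: two `k`-tuples are adjacent when they are adjacent in
one coordinate and agree in all the others. -/
def cartesianPower {V : Type*} (G : SimpleGraph V) (k : ℕ) : SimpleGraph (Fin k → V) where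
  Adj x y := ∃ i, G.Adj (x i) (y i) ∧ ∀ j, j ≠ i → x j = y j
  symm := ⟨fun _ _ ⟨i, hi, h⟩ => ⟨i, hi.symm, fun j hj => (h j hj).symm⟩⟩
  loopless := ⟨fun _ ⟨_, hi, _⟩ => hi.ne rfl⟩

/-- The additive group `ℤ₄^{2m} × ℤ₂^{2n'} × ℤ₄^{n''}`. The coordinates of the first two parts
are grouped in the consecutive pairs `(2i - 1, 2i)`, one pair for each factor `Sh` or `K`. -/
abbrev Space (m n' n'' : ℕ) : Type :=
  (Fin m → ZMod 4 × ZMod 4) × (Fin n' → ZMod 2 × ZMod 2) × (Fin n'' → ZMod 4)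

/-- The graph `D(m, n' + n'') = Sh^m □ K^{n'} □ K^{n''}` on `ℤ₄^{2m} × ℤ₂^{2n'} × ℤ₄^{n''}`. -/
def graph (m n' n'' : ℕ) : SimpleGraph (Space m n' n'') :=
  (cartesianPower shrikhande m).boxProd
    ((cartesianPower completeZ2 n').boxProd (cartesianPower completeZ4 n''))

/-- A `1`-perfect code in a graph: an independent set `C` such that every vertex outside `C` is
adjacent to exactly one vertex of `C`. -/
def IsOnePerfect {V : Type*} (G : SimpleGraph V) (C : Set V) : Prop :=
  G.IsIndepSet C ∧ ∀ v, v ∉ C → ∃! c, c ∈ C ∧ G.Adj v c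

end Doob

namespace Doob

/-! Let `Q` be the quotient by a subgroup `C`. Then `C` is a 1-perfect code iff the zero vertex and
its neighbours map bijectively onto `Q` (`isOnePerfect_graph_iff`). So the question is how to
partition `Q \ {0}` into `m` blocks `{±a, ±b, ±(a+b)}`, `n'` lines `{a, b, a+b}` with `2a = 2b = 0`,
and `n''` blocks `{e, 2e, 3e}`.

Necessity: `Q` has type `ℤ₂^Γ × ℤ₄^Δ`. Counting `Q` and the kernel of doubling gives the two
equations (`card_ker_double`). The elements `2e` are distinct, nonzero and doubles, which bounds
`n''` (`lt_card_range_double`). If `n'' = 1`, summing over `Q` a character that factors through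
doubling forces `|Q| = 4` (`card_mod_eight`), which is the excluded triple.

Sufficiency: a Shrikhande block together with its doubled line `{2a, 2b, 2a+2b}` is also the union
of the cyclic blocks of `a`, `b`, `a+b`. Exchanging such pairs raises `n''` by three at a time, so
it is enough to find, for each type, one tiling with the fewest cyclic blocks (0 or 4) and the most
exchangeable pairs (`exists_code_of_hasTiling`). These grow from the trivial group and `ℤ₄³` by
adjoining factors `ℤ₂²` and `ℤ₄²` (`HasTiling.prod_two`, `HasTiling.prod_four`). -/

/-- A Cayley-type description of 1-perfect codes: when adjacency is translation by the generators
`g`, the kernel of `φ` is a 1-perfect code iff the unit ball maps bijectively under `φ`. -/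
theorem isOnePerfect_ker_iff {A Q ι : Type*} [AddCommGroup A] [AddCommGroup Q]
    {G : SimpleGraph A} {g : ι → A} (hadj : ∀ x y, G.Adj x y ↔ ∃ s, y - x = g s)
    (hg : Function.Injective g) (φ : A →+ Q) (hφ : Function.Surjective φ) :
    IsOnePerfect G (φ.ker : Set A) ↔
      Function.Bijective fun o : Option ι => o.elim 0 fun s => φ (g s) := by
  have hg0 : ∀ s, g s ≠ 0 := fun s hs => G.loopless.irrefl 0 ((hadj 0 0).2 ⟨s, by simp [hs]⟩)
  constructor
  · rintro ⟨hind, hcov⟩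
    have hne : ∀ s, φ (g s) ≠ 0 := fun s hs =>
      hind (show (0 : A) ∈ (φ.ker : Set A) by simp) (show g s ∈ (φ.ker : Set A) from hs)
        (hg0 s).symm ((hadj _ _).2 ⟨s, by simp⟩)
    refine ⟨?_, fun q => ?_⟩
    · rintro (_ | s) (_ | t) h
      · rfl
      · exact absurd h.symm (hne t)
      · exact absurd h (hne s)
      · have h : φ (g s) = φ (g t) := h
        -- The vertex `-g s` is adjacent both to `0` and to `-g s + g t`, and both lie in the
        -- kernel.
        obtain ⟨c, -, hc⟩ := hcov (-g s) (by simpa using hne s)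
        have h1 := hc 0 ⟨by simp, (hadj _ _).2 ⟨s, by simp⟩⟩
        have h2 := hc (-g s + g t) ⟨by simp [h], (hadj _ _).2 ⟨t, by simp⟩⟩
        have h3 : -g s + g t = 0 := h2.trans h1.symm
        rw [hg (neg_add_eq_zero.1 h3)]
    · obtain ⟨v, rfl⟩ := hφ q
      by_cases hv : φ v = 0
      · exact ⟨none, hv.symm⟩
      · obtain ⟨c, ⟨hc, hvc⟩, -⟩ := hcov (-v) (by simpa using hv)
        obtain ⟨s, hs⟩ := (hadj _ _).1 hvc
        refine ⟨some s, ?_⟩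
        have hc : φ c = 0 := hc
        simp [← hs, hc]
  · rintro ⟨hinj, hsurj⟩
    refine ⟨fun x hx y hy _ hxy => ?_, fun v hv => ?_⟩
    · obtain ⟨s, hs⟩ := (hadj _ _).1 hxy
      have hx : φ x = 0 := hx
      have hy : φ y = 0 := hy
      have := @hinj (some s) none (by simp [← hs, hx, hy])
      cases this
    · obtain ⟨o, ho⟩ := hsurj (φ (-v))
      have hv : φ v ≠ 0 := hv
      rcases o with _ | s
      · exact absurd ho.symm (by simpa using hv)
      · have ho : φ (g s) = φ (-v) := ho
        refine ⟨v + g s, ⟨by simp [ho], (hadj _ _).2 ⟨s, by simp⟩⟩, ?_⟩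
        rintro c ⟨hc, hvc⟩
        obtain ⟨t, ht⟩ := (hadj _ _).1 hvc
        have hc : φ c = 0 := hc
        have : some t = some s := hinj (by simp [ho, ← ht, hc])
        rw [← Option.some.inj this, ← ht]
        abel

/-! ### Adjacency in the Doob graph as translation by generators -/

/-- The generators of the Shrikhande graph. -/
def shGens : Finset (ZMod 4 × ZMod 4) := {(0, 1), (3, 0), (3, 3), (0, 3), (1, 0), (1, 1)}

/-- The generators of the complete graph on `ℤ₂²`. -/
def twoGens : Finset (ZMod 2 × ZMod 2) := {(0, 1), (1, 0), (1, 1)}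

/-- The generators of the complete graph on `ℤ₄`. -/
def fourGens : Finset (ZMod 4) := {1, 2, 3}

theorem shrikhande_adj (x y : ZMod 4 × ZMod 4) : shrikhande.Adj x y ↔ y - x ∈ shGens := by
  rw [shrikhande, SimpleGraph.addCayley_adj']
  revert x y
  decide

theorem completeZ2_adj (x y : ZMod 2 × ZMod 2) : completeZ2.Adj x y ↔ y - x ∈ twoGens := by
  rw [completeZ2, SimpleGraph.addCayley_adj']
  revert x y
  decide

theorem completeZ4_adj (x y : ZMod 4) : completeZ4.Adj x y ↔ y - x ∈ fourGens := by
  rw [completeZ4, SimpleGraph.addCayley_adj']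
  revert x y
  decide

theorem cartesianPower_adj {V : Type*} [AddCommGroup V] {G : SimpleGraph V} {S : Finset V}
    (hG : ∀ x y, G.Adj x y ↔ y - x ∈ S) {k : ℕ} (x y : Fin k → V) :
    (cartesianPower G k).Adj x y ↔ ∃ s : Fin k × S, y - x = Pi.single s.1 s.2.1 := by
  constructor
  · rintro ⟨i, hi, h⟩
    refine ⟨(i, ⟨y i - x i, (hG _ _).1 hi⟩), ?_⟩
    funext j
    by_cases hj : j = i
    · subst hj; simp
    · simp [hj, h j hj]
  · rintro ⟨⟨i, g, hg⟩, h⟩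
    refine ⟨i, (hG _ _).2 ?_, fun j hj => ?_⟩
    · rw [← Pi.sub_apply, h]; simpa using hg
    · have := congrFun h j
      simp only [Pi.sub_apply, Pi.single_eq_of_ne hj] at this
      exact (sub_eq_zero.1 this).symm

/-- Indices for the neighbours of zero in `graph m n' n''`. -/
abbrev Gen (m n' n'' : ℕ) : Type :=
  (Fin m × shGens) ⊕ (Fin n' × twoGens) ⊕ (Fin n'' × fourGens)

/-- The neighbours of zero in `graph m n' n''`. -/
def gen {m n' n'' : ℕ} : Gen m n' n'' → Space m n' n''
  | .inl s => (Pi.single s.1 s.2.1, 0, 0)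
  | .inr (.inl s) => (0, Pi.single s.1 s.2.1, 0)
  | .inr (.inr s) => (0, 0, Pi.single s.1 s.2.1)

theorem graph_adj {m n' n'' : ℕ} (x y : Space m n' n'') :
    (graph m n' n'').Adj x y ↔ ∃ s : Gen m n' n'', y - x = gen s := by
  obtain ⟨x₁, x₂, x₃⟩ := x
  obtain ⟨y₁, y₂, y₃⟩ := y
  simp only [graph, SimpleGraph.boxProd_adj, cartesianPower_adj shrikhande_adj,
    cartesianPower_adj completeZ2_adj, cartesianPower_adj completeZ4_adj, Sum.exists, gen,
    Prod.mk_sub_mk, Prod.mk.injEq, sub_eq_zero, exists_and_right, exists_and_left,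
    eq_comm (a := x₁), eq_comm (a := x₂), eq_comm (a := x₃)]
  tauto

theorem single_injective {k : ℕ} {V : Type*} [AddCommGroup V] {S : Finset V} (hS : 0 ∉ S) :
    Function.Injective fun s : Fin k × S => (Pi.single s.1 s.2.1 : Fin k → V) := by
  rintro ⟨i, g, hg⟩ ⟨j, h, hh⟩ e
  have h1 := congrFun e i
  by_cases hij : i = j
  · subst hij; simpa using h1
  · simp only [Pi.single_eq_same, Pi.single_eq_of_ne hij] at h1
    exact absurd (h1 ▸ hg) hS

theorem single_ne_zero {k : ℕ} {V : Type*} [AddCommGroup V] {S : Finset V} (hS : 0 ∉ S)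
    (s : Fin k × S) : (Pi.single s.1 s.2.1 : Fin k → V) ≠ 0 := by
  rw [Ne, Pi.single_eq_zero_iff]
  exact fun h => hS (h ▸ s.2.2)

theorem gen_injective {m n' n'' : ℕ} : Function.Injective (gen : Gen m n' n'' → _) := by
  have h1 : (0 : ZMod 4 × ZMod 4) ∉ shGens := by decide
  have h2 : (0 : ZMod 2 × ZMod 2) ∉ twoGens := by decide
  have h3 : (0 : ZMod 4) ∉ fourGens := by decide
  rintro (s | s | s) (t | t | t) h <;> simp only [gen, Prod.mk.injEq] at h
  · rw [single_injective h1 h.1]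
  · exact absurd h.1 (single_ne_zero h1 s)
  · exact absurd h.1 (single_ne_zero h1 s)
  · exact absurd h.1.symm (single_ne_zero h1 t)
  · rw [single_injective h2 h.2.1]
  · exact absurd h.2.1 (single_ne_zero h2 s)
  · exact absurd h.1.symm (single_ne_zero h1 t)
  · exact absurd h.2.1.symm (single_ne_zero h2 t)
  · rw [single_injective h3 h.2.2]

/-- The images of the unit ball of `graph m n' n''` under a homomorphism. -/
def ballMap {m n' n'' : ℕ} {Q : Type*} [AddCommGroup Q] (φ : Space m n' n'' →+ Q)
    (o : Option (Gen m n' n'')) : Q := o.elim 0 fun s => φ (gen s)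

theorem isOnePerfect_graph_iff {m n' n'' : ℕ} {Q : Type*} [AddCommGroup Q]
    (φ : Space m n' n'' →+ Q) (hφ : Function.Surjective φ) :
    IsOnePerfect (graph m n' n'') (φ.ker : Set _) ↔ Function.Bijective (ballMap φ) :=
  isOnePerfect_ker_iff graph_adj gen_injective φ hφ

theorem card_gen (m n' n'' : ℕ) :
    Fintype.card (Option (Gen m n' n'')) = 6 * m + 3 * n' + 3 * n'' + 1 := by
  have h1 : shGens.card = 6 := by decide
  have h2 : twoGens.card = 3 := by decide
  have h3 : fourGens.card = 3 := by decide
  simp [Fintype.card_option, h1, h2, h3]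
  ring

/-! ### Doubling and the type of the quotient -/

/-- Multiplication by two. -/
abbrev double (Q : Type*) [AddCommGroup Q] : Q →+ Q := nsmulAddMonoidHom 2

theorem card_ker_mul_card_range {Q R : Type*} [AddCommGroup Q] [AddCommGroup R] [Finite Q]
    (f : Q →+ R) : Nat.card f.ker * Nat.card f.range = Nat.card Q := by
  rw [AddSubgroup.card_eq_card_quotient_mul_card_addSubgroup f.ker, mul_comm]
  congr 1
  exact (Nat.card_congr (QuotientAddGroup.quotientKerEquivRange f).toEquiv).symm

/-- The type of a finite 2-group of exponent dividing four. -/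
theorem exists_type {Q : Type*} [AddCommGroup Q] [Finite Q] (h4 : ∀ q : Q, 4 • q = 0) {N : ℕ}
    (hN : Nat.card Q ∣ 2 ^ N) : ∃ Γ Δ : ℕ, Nat.card Q = 2 ^ (Γ + 2 * Δ) ∧
      Nat.card (double Q).ker = 2 ^ (Γ + Δ) ∧ Nat.card (double Q).range = 2 ^ Δ := by
  have hmul := card_ker_mul_card_range (double Q)
  have hle : (double Q).range ≤ (double Q).ker := by
    rintro _ ⟨q, rfl⟩
    simpa [AddMonoidHom.mem_ker, smul_smul] using h4 q
  have hdvd := AddSubgroup.card_dvd_of_le hle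
  obtain ⟨k, -, hk⟩ := (Nat.dvd_prime_pow Nat.prime_two).1
    ((AddSubgroup.card_addSubgroup_dvd_card (double Q).ker).trans hN)
  obtain ⟨Δ, -, hΔ⟩ := (Nat.dvd_prime_pow Nat.prime_two).1
    ((AddSubgroup.card_addSubgroup_dvd_card (double Q).range).trans hN)
  rw [hk, hΔ] at hmul hdvd
  obtain ⟨Γ, rfl⟩ := Nat.exists_eq_add_of_le' ((Nat.pow_dvd_pow_iff_le_right one_lt_two).1 hdvd)
  refine ⟨Γ, Δ, ?_, hk, hΔ⟩
  rw [← hmul]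
  ring

/-! ### Necessary conditions -/

section Necessity

variable {m n' n'' : ℕ} {Q : Type*} [AddCommGroup Q] {φ : Space m n' n'' →+ Q}

/-- The generator of the `i`-th factor `ℤ₄` with value `g`. -/
def fourGen (m n' : ℕ) {n'' : ℕ} (i : Fin n'') (g : ZMod 4) (hg : g ∈ fourGens := by decide) :
    Gen m n' n'' := .inr (.inr (i, ⟨g, hg⟩))

/-- The points of the unit ball that are their own negatives. -/
def involutionPoint : Option (Fin n' × twoGens ⊕ Fin n'') → Option (Gen m n' n'') :=
  Option.map (Sum.elim (fun s => .inr (.inl s)) fun i => fourGen m n' i 2)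

theorem involutionPoint_injective :
    Function.Injective (involutionPoint : _ → Option (Gen m n' n'')) := by
  refine Option.map_injective ?_
  rintro (s | i) (t | j) h <;> simp_all [fourGen]

theorem two_nsmul_fourGen_one (i : Fin n'') :
    2 • φ (gen (fourGen m n' i 1)) = φ (gen (fourGen m n' i 2)) := by
  rw [← map_nsmul]
  congr 1
  simp [gen, fourGen, ← Pi.single_smul]

theorem two_nsmul_ballMap_involutionPoint (h4 : ∀ q : Q, 4 • q = 0)
    (x : Option (Fin n' × twoGens ⊕ Fin n'')) : 2 • ballMap φ (involutionPoint x) = 0 := by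
  rcases x with _ | ⟨i, g, hg⟩ | i
  · simp [involutionPoint, ballMap]
  · have : ∀ g : ZMod 2 × ZMod 2, 2 • g = 0 := by decide
    simp only [involutionPoint, ballMap, gen, Option.map_some, Sum.elim_inl, Option.elim_some,
      ← map_nsmul, Prod.smul_mk, ← Pi.single_smul, this, smul_zero, Pi.single_zero]
    exact map_zero φ
  · have := h4 (φ (gen (fourGen m n' i 1)))
    rw [show 4 • φ (gen (fourGen m n' i 1)) = 2 • 2 • φ (gen (fourGen m n' i 1)) from
      (smul_smul 2 2 (φ _)).symm, two_nsmul_fourGen_one] at this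
    exact this

/-- For every other generator, its negative is a different generator, so injectivity on the ball
separates their images and the double cannot vanish. -/
theorem exists_involutionPoint_eq (hφ : Function.Injective (ballMap φ))
    (o : Option (Gen m n' n'')) (ho : 2 • ballMap φ o = 0) :
    ∃ x, involutionPoint x = o := by
  have key : ∀ s t : Gen m n' n'', gen t = -gen s → t ≠ s → 2 • φ (gen s) ≠ 0 := by
    intro s t hst hne h
    have : some t = some s := hφ (by
      change φ (gen t) = φ (gen s)
      rw [hst, map_neg, neg_eq_iff_add_eq_zero, ← two_nsmul, h])
    exact hne (Option.some.inj this)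
  rcases o with _ | ⟨i, g, hg⟩ | s | ⟨i, g, hg⟩
  · exact ⟨none, rfl⟩
  · have h : ∀ g ∈ shGens, -g ∈ shGens ∧ -g ≠ g := by decide
    exact absurd ho (key _ (.inl (i, ⟨-g, (h g hg).1⟩)) (by simp [gen, Pi.single_neg])
      (by simpa using (h g hg).2))
  · exact ⟨some (.inl s), rfl⟩
  · by_cases hg2 : g = 2
    · subst hg2
      exact ⟨some (.inr i), rfl⟩
    · have h : ∀ g ∈ fourGens, g ≠ 2 → -g ∈ fourGens ∧ -g ≠ g := by decide
      exact absurd ho (key _ (.inr (.inr (i, ⟨-g, (h g hg hg2).1⟩)))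
        (by simp [gen, Pi.single_neg]) (by simpa using (h g hg hg2).2))

theorem card_ker_double (h4 : ∀ q : Q, 4 • q = 0) (hφ : Function.Bijective (ballMap φ)) :
    Nat.card (double Q).ker = 3 * n' + n'' + 1 := by
  let F : Option (Fin n' × twoGens ⊕ Fin n'') → (double Q).ker := fun x =>
    ⟨ballMap φ (involutionPoint x), two_nsmul_ballMap_involutionPoint h4 x⟩
  have hF : Function.Bijective F := by
    refine ⟨fun x y h => involutionPoint_injective (hφ.1 (congrArg Subtype.val h)), ?_⟩
    rintro ⟨q, hq⟩
    obtain ⟨o, rfl⟩ := hφ.2 q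
    obtain ⟨x, rfl⟩ := exists_involutionPoint_eq hφ.1 o hq
    exact ⟨x, rfl⟩
  have h2 : twoGens.card = 3 := by decide
  rw [← Nat.card_congr (Equiv.ofBijective F hF)]
  simp [Nat.card_eq_fintype_card, Fintype.card_option, h2]
  ring

theorem lt_card_range_double [Finite Q] (hφ : Function.Injective (ballMap φ)) :
    n'' + 1 ≤ Nat.card (double Q).range := by
  let F : Option (Fin n'') → (double Q).range := fun x =>
    ⟨ballMap φ (involutionPoint (x.map .inr)), by
      rcases x with _ | i
      · exact zero_mem _
      · exact ⟨φ (gen (fourGen m n' i 1)), two_nsmul_fourGen_one i⟩⟩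
  have hF : Function.Injective F := fun x y h =>
    Option.map_injective Sum.inr_injective
      (involutionPoint_injective (hφ (congrArg Subtype.val h)))
  simpa using Nat.card_le_card_of_injective F hF

/-- An element that is not killed by two is detected by a character that factors through
doubling. -/
theorem exists_character (h4 : ∀ q : Q, 4 • q = 0) {e : Q} (he : 2 • e ≠ 0) :
    ∃ χ : Q →+ ZMod 2, χ e = 1 ∧ ∀ q, 2 • q = 0 → χ q = 0 := by
  let V := (double Q).range
  let : Module (ZMod 2) V := AddCommGroup.zmodModule (by
    rintro ⟨_, q, rfl⟩
    ext
    simpa [smul_smul] using h4 q)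
  have hv : (⟨2 • e, e, rfl⟩ : V) ≠ 0 := fun h => he (congrArg Subtype.val h)
  obtain ⟨f, hf⟩ := not_forall.1
    (mt (Module.forall_dual_apply_eq_zero_iff (ZMod 2) (⟨2 • e, e, rfl⟩ : V)).1 hv)
  refine ⟨f.toAddMonoidHom.comp (double Q).rangeRestrict, ?_, fun q hq => ?_⟩
  · have : ∀ x : ZMod 2, x ≠ 0 → x = 1 := by decide
    exact this _ hf
  · have : (double Q).rangeRestrict q = 0 := Subtype.ext hq
    simp [this]

/-- Translation by `e` exchanges the fibres of `χ` over 0 and 1. -/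
theorem two_mul_sum_val [Fintype Q] (χ : Q →+ ZMod 2) {e : Q} (he : χ e = 1) :
    2 * ∑ q, (χ q).val = Fintype.card Q := by
  have h : ∑ q, (χ q).val = ∑ q, (χ (q + e)).val :=
    (Fintype.sum_equiv (Equiv.addRight e) _ _ fun _ => rfl).symm
  have hval : ∀ x : ZMod 2, x.val + (x + 1).val = 1 := by decide
  rw [two_mul]
  nth_rewrite 2 [h]
  simp [← Finset.sum_add_distrib, he, hval]

/-- Modulo two the six generators hit each nonzero class of `ℤ₂²` twice, and a nonzero `θ` equals 1
on two of the three classes. -/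
theorem four_dvd_sum_shGens (θ : ZMod 4 × ZMod 4 →+ ZMod 2) :
    4 ∣ ∑ g : shGens, (θ g).val := by
  have h : ∀ g, θ g = g.1.val • θ (1, 0) + g.2.val • θ (0, 1) := by
    intro g
    rw [← map_nsmul, ← map_nsmul, ← map_add]
    congr 1
    revert g
    decide
  rw [Finset.sum_coe_sort shGens fun g => (θ g).val, Finset.sum_congr rfl fun g _ => by rw [h g]]
  generalize θ (1, 0) = u
  generalize θ (0, 1) = v
  revert u v
  decide

/-- The sum of `χ` is half of `|Q|`. Each Shrikhande block contributes a multiple of 4, lines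
contribute 0, and the only cyclic block contributes 2, from `e` and `3e`. -/
theorem card_mod_eight [Fintype Q] {φ : Space m n' 1 →+ Q} (h4 : ∀ q : Q, 4 • q = 0)
    (hφ : Function.Bijective (ballMap φ)) : Fintype.card Q % 8 = 4 := by
  have he : 2 • φ (gen (fourGen m n' 0 1)) ≠ 0 := by
    rw [two_nsmul_fourGen_one]
    intro h
    have := @hφ.1 (some (fourGen m n' 0 2)) none h
    cases this
  obtain ⟨χ, hχ, hχ2⟩ := exists_character h4 he
  have hsum := two_mul_sum_val χ hχ
  rw [← hφ.sum_comp fun q => (χ q).val, Fintype.sum_option, Fintype.sum_sum_type,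
    Fintype.sum_sum_type] at hsum
  have h0 : (χ (ballMap φ none)).val = 0 := by simp [ballMap]
  have h1 : 4 ∣ ∑ s : Fin m × shGens, (χ (ballMap φ (some (.inl s)))).val := by
    rw [Fintype.sum_prod_type]
    refine Finset.dvd_sum fun i _ => ?_
    exact four_dvd_sum_shGens ((χ.comp φ).comp ((AddMonoidHom.inl _ _).comp
      (AddMonoidHom.single (fun _ : Fin m => ZMod 4 × ZMod 4) i)))
  have h2 : ∑ s : Fin n' × twoGens, (χ (ballMap φ (some (.inr (.inl s))))).val = 0 :=
    Finset.sum_eq_zero fun s _ =>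
      (congrArg ZMod.val (hχ2 _ (two_nsmul_ballMap_involutionPoint h4 (some (.inl s))))).trans
        ZMod.val_zero
  have h3 : ∑ s : Fin 1 × fourGens, (χ (ballMap φ (some (.inr (.inr s))))).val = 2 := by
    let θ : ZMod 4 →+ ZMod 2 := (χ.comp φ).comp ((AddMonoidHom.inr _ _).comp
      ((AddMonoidHom.inr _ _).comp (AddMonoidHom.single (fun _ : Fin 1 => ZMod 4) 0)))
    have hθ1 : θ 1 = 1 := hχ
    have hθ : ∀ g : ZMod 4, θ g = g.val • (1 : ZMod 2) := by
      intro g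
      rw [← hθ1, ← map_nsmul]
      congr 1
      revert g
      decide
    rw [Fintype.sum_prod_type, Fin.sum_univ_one]
    change ∑ g : fourGens, (θ g).val = 2
    rw [Finset.sum_coe_sort fourGens fun g => (θ g).val,
      Finset.sum_congr rfl fun g _ => by rw [hθ g]]
    decide
  omega

end Necessity

theorem exists_parameters_of_code {m n' n'' : ℕ} (hne : (m, n', n'') ≠ (0, 0, 1))
    (C : AddSubgroup (Space m n' n''))
    (hC : IsOnePerfect (graph m n' n'') (C : Set (Space m n' n''))) :
    ∃ Γ Δ : ℕ, 2 ^ (Γ + 2 * Δ) = 6 * m + 3 * n' + 3 * n'' + 1 ∧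
      2 ^ (Γ + Δ) = 3 * n' + n'' + 1 ∧ n'' + 1 ≤ 2 ^ Δ ∧ n'' ≠ 1 := by
  have hφ := (isOnePerfect_graph_iff (QuotientAddGroup.mk' C)
    (QuotientAddGroup.mk'_surjective C)).1 (by rwa [QuotientAddGroup.ker_mk'])
  have h4 : ∀ q : Space m n' n'' ⧸ C, 4 • q = 0 := by
    intro q
    obtain ⟨v, rfl⟩ := QuotientAddGroup.mk'_surjective C q
    have h1 : ∀ x : ZMod 4 × ZMod 4, 4 • x = 0 := by decide
    have h2 : ∀ x : ZMod 2 × ZMod 2, 4 • x = 0 := by decide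
    have h3 : ∀ x : ZMod 4, 4 • x = 0 := by decide
    have : 4 • v = 0 := by
      ext1
      · funext i; exact h1 _
      · ext1
        · funext i; exact h2 _
        · funext i; exact h3 _
    rw [← map_nsmul, this, map_zero]
  have hN : Nat.card (Space m n' n'' ⧸ C) ∣ 2 ^ (4 * m + 2 * n' + 2 * n'') := by
    refine (AddSubgroup.card_quotient_dvd_card C).trans (dvd_of_eq ?_)
    simp [Nat.card_eq_fintype_card, ZMod.card, pow_add, pow_mul, mul_assoc]
  obtain ⟨Γ, Δ, hQ, hK, hR⟩ := exists_type h4 hN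
  have hcard : Nat.card (Space m n' n'' ⧸ C) = 6 * m + 3 * n' + 3 * n'' + 1 := by
    rw [← card_gen, ← Nat.card_eq_fintype_card]
    exact (Nat.card_congr (Equiv.ofBijective _ hφ)).symm
  refine ⟨Γ, Δ, by rw [← hQ, hcard], by rw [← hK, card_ker_double h4 hφ],
    by rw [← hR]; exact lt_card_range_double hφ.1, ?_⟩
  rintro rfl
  let := Fintype.ofFinite (Space m n' 1 ⧸ C)
  have hmod := card_mod_eight h4 hφ
  rw [← Nat.card_eq_fintype_card] at hmod
  -- A power of two congruent to 4 modulo 8 is 4, which leaves no room for another factor besides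
  -- the single `ℤ₄`.
  have h2 : Γ + 2 * Δ ≤ 2 := by
    by_contra! h
    have : 2 ^ 3 ∣ Nat.card (Space m n' 1 ⧸ C) := hQ ▸ pow_dvd_pow 2 h
    omega
  have h3 : 2 ^ (Γ + 2 * Δ) ≤ 2 ^ 2 := Nat.pow_le_pow_right (by norm_num) h2
  exact hne (by simp; omega)

/-! ### From block covers of a group to codes -/

section Blocks

variable {Q : Type*} [AddCommGroup Q]

/-- The image of the generators of `Sh` under a homomorphism with values `p.1`, `p.2` on the
standard generators of `ℤ₄²`. -/
def InSh (p : Q × Q) (q : Q) : Prop :=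
  q = p.1 ∨ q = -p.1 ∨ q = p.2 ∨ q = -p.2 ∨ q = p.1 + p.2 ∨ q = -(p.1 + p.2)

/-- The nonzero part of the span of `p.1` and `p.2`, when these have order two. -/
def InLine (p : Q × Q) (q : Q) : Prop := q = p.1 ∨ q = p.2 ∨ q = p.1 + p.2

/-- The nonzero part of the cyclic group generated by `e`, when it has order four. -/
def InCyc (e q : Q) : Prop := q = e ∨ q = 2 • e ∨ q = 3 • e

instance [DecidableEq Q] (p : Q × Q) (q : Q) : Decidable (InSh p q) := by
  unfold InSh; infer_instance

instance [DecidableEq Q] (p : Q × Q) (q : Q) : Decidable (InLine p q) := by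
  unfold InLine; infer_instance

instance [DecidableEq Q] (e q : Q) : Decidable (InCyc e q) := by
  unfold InCyc; infer_instance

theorem InLine.inSh {p : Q × Q} {q : Q} (h : InLine p q) : InSh p q := by
  rcases h with h | h | h <;> simp [InSh, h]

theorem InLine.inSh_neg {p : Q × Q} {q : Q} (h : InLine p q) : InSh (-p) q := by
  rcases h with h | h | h <;> simp [InSh, h, add_comm]

/-- The homomorphism `ℤ_n → Q` with prescribed value at one. -/
def zmodHom (n : ℕ) (q : Q) (h : n • q = 0) : ZMod n →+ Q :=
  ZMod.lift n ⟨zmultiplesHom Q q, by simpa using h⟩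

theorem zmodHom_one {n : ℕ} {q : Q} (h : n • q = 0) : zmodHom n q h 1 = q := by
  have := ZMod.lift_coe n (⟨zmultiplesHom Q q, by simpa using h⟩ : {f : ℤ →+ Q // f n = 0}) 1
  simpa [zmodHom] using this

/-- The homomorphism `ℤ_n² → Q` with prescribed values at the standard generators. -/
def zmodPairHom (n : ℕ) (p : Q × Q) (h : n • p.1 = 0 ∧ n • p.2 = 0) : ZMod n × ZMod n →+ Q :=
  (zmodHom n p.1 h.1).coprod (zmodHom n p.2 h.2)

theorem zmodPairHom_fst {n : ℕ} {p : Q × Q} (h : n • p.1 = 0 ∧ n • p.2 = 0) :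
    zmodPairHom n p h (1, 0) = p.1 := by
  simp [zmodPairHom, zmodHom_one]

theorem zmodPairHom_snd {n : ℕ} {p : Q × Q} (h : n • p.1 = 0 ∧ n • p.2 = 0) :
    zmodPairHom n p h (0, 1) = p.2 := by
  simp [zmodPairHom, zmodHom_one]

theorem zmodPairHom_add {n : ℕ} {p : Q × Q} (h : n • p.1 = 0 ∧ n • p.2 = 0) :
    zmodPairHom n p h (1, 1) = p.1 + p.2 := by
  simp [zmodPairHom, zmodHom_one]

theorem exists_shGens {p : Q × Q} (h : 4 • p.1 = 0 ∧ 4 • p.2 = 0) {q : Q} (hq : InSh p q) :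
    ∃ g : shGens, zmodPairHom 4 p h g = q := by
  have h1 := zmodPairHom_fst h
  have h2 := zmodPairHom_snd h
  have h3 := zmodPairHom_add h
  rcases hq with rfl | rfl | rfl | rfl | rfl | rfl
  · exact ⟨⟨(1, 0), by decide⟩, h1⟩
  · exact ⟨⟨-(1, 0), by decide⟩, by rw [map_neg, h1]⟩
  · exact ⟨⟨(0, 1), by decide⟩, h2⟩
  · exact ⟨⟨-(0, 1), by decide⟩, by rw [map_neg, h2]⟩
  · exact ⟨⟨(1, 1), by decide⟩, h3⟩
  · exact ⟨⟨-(1, 1), by decide⟩, by rw [map_neg, h3]⟩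

theorem exists_twoGens {p : Q × Q} (h : 2 • p.1 = 0 ∧ 2 • p.2 = 0) {q : Q} (hq : InLine p q) :
    ∃ g : twoGens, zmodPairHom 2 p h g = q := by
  rcases hq with rfl | rfl | rfl
  · exact ⟨⟨(1, 0), by decide⟩, zmodPairHom_fst h⟩
  · exact ⟨⟨(0, 1), by decide⟩, zmodPairHom_snd h⟩
  · exact ⟨⟨(1, 1), by decide⟩, zmodPairHom_add h⟩

theorem exists_fourGens {e : Q} (h : 4 • e = 0) {q : Q} (hq : InCyc e q) :
    ∃ g : fourGens, zmodHom 4 e h g = q := by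
  rcases hq with rfl | rfl | rfl
  · exact ⟨⟨1, by decide⟩, zmodHom_one h⟩
  · refine ⟨⟨2 • 1, by decide⟩, by rw [map_nsmul, zmodHom_one h]⟩
  · refine ⟨⟨3 • 1, by decide⟩, by rw [map_nsmul, zmodHom_one h]⟩

/-- The homomorphism on a power of `V` with prescribed components. -/
def piSum {k : ℕ} {V : Type*} [AddCommGroup V] (f : Fin k → V →+ Q) : (Fin k → V) →+ Q :=
  ∑ i, (f i).comp (Pi.evalAddMonoidHom _ i)

theorem piSum_single {k : ℕ} {V : Type*} [AddCommGroup V] (f : Fin k → V →+ Q) (i : Fin k)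
    (v : V) : piSum f (Pi.single i v) = f i v := by
  rw [piSum, AddMonoidHom.finsetSum_apply, Finset.sum_eq_single i]
  · simp
  · intro j _ hj
    simp [Pi.single_eq_of_ne hj]
  · simp

/-- Disjointness of the blocks need not be checked: a cover whose total size is `|Q|` makes the map
from the ball surjective between sets of equal size, hence bijective. -/
theorem exists_code_of_cover [Fintype Q] (h4 : ∀ q : Q, 4 • q = 0) {S L : List (Q × Q)}
    {E : List Q} (hL : ∀ p ∈ L, 2 • p.1 = 0 ∧ 2 • p.2 = 0)
    (hcov : ∀ q : Q, q ≠ 0 → (∃ p ∈ S, InSh p q) ∨ (∃ p ∈ L, InLine p q) ∨ ∃ e ∈ E, InCyc e q)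
    (hcard : Fintype.card Q = 6 * S.length + 3 * L.length + 3 * E.length + 1) :
    ∃ C : AddSubgroup (Space S.length L.length E.length),
      IsOnePerfect (graph S.length L.length E.length) (C : Set _) := by
  let f₁ (i : Fin S.length) := zmodPairHom 4 S[i] ⟨h4 _, h4 _⟩
  let f₂ (i : Fin L.length) := zmodPairHom 2 L[i] (hL _ (List.getElem_mem _))
  let f₃ (i : Fin E.length) := zmodHom 4 E[i] (h4 _)
  let φ : Space S.length L.length E.length →+ Q :=
    (piSum f₁).coprod ((piSum f₂).coprod (piSum f₃))
  have hsurj : Function.Surjective (ballMap φ) := by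
    intro q
    by_cases hq : q = 0
    · exact ⟨none, hq.symm⟩
    rcases hcov q hq with ⟨p, hp, h⟩ | ⟨p, hp, h⟩ | ⟨p, hp, h⟩
    · obtain ⟨i, hi, rfl⟩ := List.getElem_of_mem hp
      obtain ⟨g, hg⟩ := exists_shGens ⟨h4 _, h4 _⟩ h
      refine ⟨some (.inl (⟨i, hi⟩, g)), ?_⟩
      simpa [ballMap, gen, φ, piSum_single, f₁] using hg
    · obtain ⟨i, hi, rfl⟩ := List.getElem_of_mem hp
      obtain ⟨g, hg⟩ := exists_twoGens (hL _ hp) h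
      refine ⟨some (.inr (.inl (⟨i, hi⟩, g))), ?_⟩
      simpa [ballMap, gen, φ, piSum_single, f₂] using hg
    · obtain ⟨i, hi, rfl⟩ := List.getElem_of_mem hp
      obtain ⟨g, hg⟩ := exists_fourGens (h4 _) h
      refine ⟨some (.inr (.inr (⟨i, hi⟩, g))), ?_⟩
      simpa [ballMap, gen, φ, piSum_single, f₃] using hg
  have hbij : Function.Bijective (ballMap φ) :=
    (Fintype.bijective_iff_surjective_and_card _).2 ⟨hsurj, by rw [card_gen, hcard]⟩
  have hφ : Function.Surjective φ := by
    intro q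
    obtain ⟨_ | s, rfl⟩ := hsurj q
    · exact ⟨0, map_zero φ⟩
    · exact ⟨gen s, rfl⟩
  exact ⟨φ.ker, (isOnePerfect_graph_iff φ hφ).2 hbij⟩

end Blocks

/-! ### Tilings with exchangeable blocks -/

/-- A group of type `ℤ₂^Γ × ℤ₄^Δ` with a complete automorphism, whose nonzero elements are covered
by Shrikhande blocks `S`, lines `L`, `e` cyclic blocks `E`, and blocks `J` consisting of a
Shrikhande block and its double. A block of the last kind is also the union of three cyclic
blocks. -/
structure HasTiling (Q : Type*) [AddCommGroup Q] (Γ Δ e : ℕ) : Prop where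
  four_nsmul : ∀ q : Q, 4 • q = 0
  card : Nat.card Q = 2 ^ (Γ + 2 * Δ)
  card_ker : Nat.card (double Q).ker = 2 ^ (Γ + Δ)
  card_range : Nat.card (double Q).range = 2 ^ Δ
  complete : ∃ f : Q →+ Q, Function.Bijective f ∧ Function.Bijective (AddMonoidHom.id Q + f)
  tiling : ∃ (S L : List (Q × Q)) (E : List Q) (J : List (Q × Q)),
    (∀ p ∈ L, 2 • p.1 = 0 ∧ 2 • p.2 = 0) ∧
    (∀ q : Q, q ≠ 0 → (∃ p ∈ S, InSh p q) ∨ (∃ p ∈ L, InLine p q) ∨ (∃ e ∈ E, InCyc e q) ∨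
      ∃ p ∈ J, InSh p q ∨ InLine (2 • p) q) ∧
    E.length = e ∧
    6 * (S.length + J.length) + 3 * (L.length + J.length) + 3 * e + 1 = 2 ^ (Γ + 2 * Δ) ∧
    3 * (L.length + J.length) + e + 1 = 2 ^ (Γ + Δ) ∧
    e + 3 * J.length + 1 = 2 ^ Δ

theorem HasTiling.finite {Q : Type*} [AddCommGroup Q] {Γ Δ e : ℕ} (h : HasTiling Q Γ Δ e) :
    Finite Q :=
  Nat.finite_of_card_ne_zero (by rw [h.card]; positivity)

theorem exists_code_of_hasTiling {Q : Type*} [AddCommGroup Q] {Γ Δ e m n' t : ℕ}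
    (h : HasTiling Q Γ Δ e) (h1 : 6 * m + 3 * n' + 3 * (e + 3 * t) + 1 = 2 ^ (Γ + 2 * Δ))
    (h2 : 3 * n' + (e + 3 * t) + 1 = 2 ^ (Γ + Δ)) (h3 : e + 3 * t + 1 ≤ 2 ^ Δ) :
    ∃ C : AddSubgroup (Space m n' (e + 3 * t)),
      IsOnePerfect (graph m n' (e + 3 * t)) (C : Set _) := by
  have := h.finite
  let := Fintype.ofFinite Q
  obtain ⟨S, L, E, J, hL, hcov, hE, c1, c2, c3⟩ := h.tiling
  have h4 := h.four_nsmul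
  -- The first `t` blocks of `J` are read as three cyclic blocks each, the others as a Shrikhande
  -- block and a line. The bound `h3` gives `t ≤ J.length`, and the two counting equations then fix
  -- the other lengths.
  let S' := S ++ J.drop t
  let L' := L ++ (J.drop t).map (2 • ·)
  let E' := E ++ ((J.take t).map Prod.fst ++ ((J.take t).map Prod.snd ++
    (J.take t).map fun p => p.1 + p.2))
  have hS' : S'.length = m := by simp [S']; omega
  have hL' : L'.length = n' := by simp [L']; omega
  have hE' : E'.length = e + 3 * t := by simp [E']; omega
  rw [← hS', ← hL', ← hE']
  refine exists_code_of_cover h4 ?_ ?_ ?_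
  · intro p hp
    simp only [L', List.mem_append, List.mem_map] at hp
    rcases hp with hp | ⟨p, -, rfl⟩
    · exact hL p hp
    · simp [smul_smul, h4]
  · intro q hq
    rcases hcov q hq with ⟨p, hp, h⟩ | ⟨p, hp, h⟩ | ⟨p, hp, h⟩ | ⟨p, hp, h⟩
    · exact .inl ⟨p, by simp [S', hp], h⟩
    · exact .inr (.inl ⟨p, by simp [L', hp], h⟩)
    · exact .inr (.inr ⟨p, by simp [E', hp], h⟩)
    · rw [← List.take_append_drop t J, List.mem_append] at hp
      rcases hp with hp | hp
      · have h3 : ∀ x : Q, -x = 3 • x := fun x => by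
          rw [neg_eq_iff_add_eq_zero, ← succ_nsmul', h4]
        have e1 : p.1 ∈ E' := List.mem_append_right _
          (List.mem_append_left _ (List.mem_map_of_mem hp))
        have e2 : p.2 ∈ E' := List.mem_append_right _
          (List.mem_append_right _ (List.mem_append_left _ (List.mem_map_of_mem hp)))
        have e3 : p.1 + p.2 ∈ E' := List.mem_append_right _
          (List.mem_append_right _ (List.mem_append_right _
            (List.mem_map_of_mem (f := fun p => p.1 + p.2) hp)))
        refine .inr (.inr ?_)
        rcases h with (h | h | h | h | h | h) | h | h | h
        · exact ⟨_, e1, .inl h⟩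
        · exact ⟨_, e1, .inr (.inr (h.trans (h3 _)))⟩
        · exact ⟨_, e2, .inl h⟩
        · exact ⟨_, e2, .inr (.inr (h.trans (h3 _)))⟩
        · exact ⟨_, e3, .inl h⟩
        · exact ⟨_, e3, .inr (.inr (h.trans (h3 _)))⟩
        · exact ⟨_, e1, .inr (.inl h)⟩
        · exact ⟨_, e2, .inr (.inl h)⟩
        · exact ⟨_, e3, .inr (.inl (by rw [h]; simp))⟩
      · rcases h with h | h
        · exact .inl ⟨p, List.mem_append_right _ hp, h⟩
        · exact .inr (.inl ⟨2 • p, List.mem_append_right _ (List.mem_map_of_mem hp), h⟩)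
  · rw [hS', hL', hE', h1, ← h.card, Nat.card_eq_fintype_card]

/-! ### Doubling on products, and lists of representatives -/

section Product

variable (Q R : Type*) [AddCommGroup Q] [AddCommGroup R]

theorem card_ker_double_prod : Nat.card (double (Q × R)).ker =
    Nat.card (double Q).ker * Nat.card (double R).ker := by
  have : (double (Q × R)).ker = (double Q).ker.prod (double R).ker := by
    ext ⟨q, r⟩
    simp [AddSubgroup.mem_prod, AddMonoidHom.mem_ker]
  rw [this, ← Nat.card_prod]
  exact Nat.card_congr (AddSubgroup.prodEquiv _ _).toEquiv

theorem card_range_double_prod : Nat.card (double (Q × R)).range =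
    Nat.card (double Q).range * Nat.card (double R).range := by
  have : (double (Q × R)).range = (double Q).range.prod (double R).range := by
    ext ⟨q, r⟩
    simp [AddSubgroup.mem_prod, AddMonoidHom.mem_range]
  rw [this, ← Nat.card_prod]
  exact Nat.card_congr (AddSubgroup.prodEquiv _ _).toEquiv

theorem card_ker_double_zmod_two : Nat.card (double (ZMod 2)).ker = 2 := by
  rw [Nat.card_eq_fintype_card]; decide

theorem card_range_double_zmod_two : Nat.card (double (ZMod 2)).range = 1 := by
  rw [Nat.card_eq_fintype_card]; decide

theorem card_ker_double_zmod_four : Nat.card (double (ZMod 4)).ker = 2 := by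
  rw [Nat.card_eq_fintype_card]; decide

theorem card_range_double_zmod_four : Nat.card (double (ZMod 4)).range = 2 := by
  rw [Nat.card_eq_fintype_card]; decide

end Product

section Lists

variable {Q : Type*} [AddCommGroup Q] [Finite Q]

theorem exists_list_of_set {α : Type*} [Finite α] (s : Set α) :
    ∃ l : List α, (∀ x, x ∈ l ↔ x ∈ s) ∧ l.length = s.ncard :=
  ⟨s.toFinite.toFinset.toList, by simp, by
    rw [Finset.length_toList, ← Set.ncard_coe_finset, Set.Finite.coe_toFinset]⟩

/-- Representatives of the elements of order four up to sign. -/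
theorem exists_half (Q : Type*) [AddCommGroup Q] [Finite Q] :
    ∃ T : List Q, (∀ q, 2 • q ≠ 0 → q ∈ T ∨ -q ∈ T) ∧
      2 * T.length + Nat.card (double Q).ker = Nat.card Q := by
  -- An arbitrary numbering chooses between `q` and `-q`; ties occur exactly on the kernel of
  -- doubling.
  obtain ⟨n, ⟨r⟩⟩ := Finite.exists_equiv_fin Q
  obtain ⟨T, hT, hlen⟩ := exists_list_of_set {q : Q | r q < r (-q)}
  have hker : ((double Q).ker : Set Q) = {q : Q | r q = r (-q)} := by
    ext q
    simp [AddMonoidHom.mem_ker, two_nsmul, eq_neg_iff_add_eq_zero]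
  have hneg : {q : Q | r (-q) < r q}.ncard = T.length := by
    rw [hlen, ← Set.ncard_image_of_injective _ neg_injective]
    congr 1
    ext q
    simp
  have h1 : {q : Q | r q < r (-q)} ∪ {q : Q | r (-q) < r q} = ((double Q).ker : Set Q)ᶜ := by
    rw [hker]
    ext q
    simp
  have h2 : Disjoint {q : Q | r q < r (-q)} {q : Q | r (-q) < r q} :=
    Set.disjoint_left.2 fun q (h : r q < r (-q)) (h' : r (-q) < r q) => lt_asymm h h'
  have h3 := Set.ncard_union_eq h2
  have h4 := Set.ncard_add_ncard_compl ((double Q).ker : Set Q)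
  rw [h1, hneg, ← hlen] at h3
  refine ⟨T, fun q hq => ?_, ?_⟩
  · rw [hT, hT]
    have : r q ≠ r (-q) := fun h => hq (hker.ge h)
    simpa using lt_or_gt_of_ne this
  · change Nat.card (double Q).ker + _ = _ at h4
    omega

theorem exists_list_ker (Q : Type*) [AddCommGroup Q] [Finite Q] :
    ∃ K : List Q, (∀ q, q ∈ K ↔ 2 • q = 0) ∧ K.length = Nat.card (double Q).ker :=
  exists_list_of_set ((double Q).ker : Set Q)

/-- Representatives `A` of the cosets of the kernel of doubling, the list `B` of the other
elements, and the list `M` of the elements killed by two that are not doubles. -/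
theorem exists_lifts (h4 : ∀ q : Q, 4 • q = 0) :
    ∃ A B M : List Q, (∀ q, q ∈ A ∨ q ∈ B) ∧ A.length + B.length = Nat.card Q ∧
      A.length = Nat.card (double Q).range ∧ (∀ q ∈ M, 2 • q = 0) ∧
      (∀ q, 2 • q = 0 → q ∈ M ∨ ∃ a ∈ A, 2 • a = q) ∧
      M.length + A.length = Nat.card (double Q).ker := by
  choose g hg using fun v : (double Q).range => v.2
  have hinj : Function.Injective g := fun v w h => Subtype.ext (by rw [← hg v, ← hg w, h])
  obtain ⟨A, hA, hA'⟩ := exists_list_of_set (Set.range g)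
  obtain ⟨B, hB, hB'⟩ := exists_list_of_set (Set.range g)ᶜ
  obtain ⟨M, hM, hM'⟩ := exists_list_of_set (((double Q).ker : Set Q) \ (double Q).range)
  have hsub : ((double Q).range : Set Q) ⊆ (double Q).ker := by
    rintro _ ⟨q, rfl⟩
    simpa [AddMonoidHom.mem_ker, smul_smul] using h4 q
  have hlen : A.length = Nat.card (double Q).range := by
    rw [hA', ← Set.image_univ, Set.ncard_image_of_injective _ hinj, Set.ncard_univ]
  refine ⟨A, B, M, fun q => ?_, ?_, hlen, fun q hq => ((hM q).1 hq).1, fun q hq => ?_, ?_⟩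
  · rw [hA, hB]
    exact em _
  · rw [hA', hB', Set.ncard_add_ncard_compl]
  · by_cases h : q ∈ (double Q).range
    · exact .inr ⟨g ⟨q, h⟩, (hA _).2 ⟨_, rfl⟩, hg ⟨q, h⟩⟩
    · exact .inl ((hM q).2 ⟨hq, h⟩)
  · rw [hM', hlen]
    exact Set.ncard_sdiff_add_ncard_of_subset hsub

end Lists

/-! ### Extending a tiling by a factor of rank two -/

section Extension

variable {Q R : Type*} [AddCommGroup Q] [AddCommGroup R]

theorem complete_prod {f : Q →+ Q} {g : R →+ R} (hf : Function.Bijective f)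
    (hf' : Function.Bijective (AddMonoidHom.id Q + f)) (hg : Function.Bijective g)
    (hg' : Function.Bijective (AddMonoidHom.id R + g)) :
    ∃ F : Q × R →+ Q × R, Function.Bijective F ∧
      Function.Bijective (AddMonoidHom.id (Q × R) + F) :=
  ⟨f.prodMap g, hf.prodMap hg, hf'.prodMap hg'⟩

/-- The inclusion of pairs of elements of `Q` in pairs of elements of `Q × R`. -/
def inclPair (p : Q × Q) : (Q × R) × (Q × R) := ((p.1, 0), (p.2, 0))

theorem InSh.incl {p : Q × Q} {q : Q} (h : InSh p q) : InSh (inclPair p) ((q, 0) : Q × R) := by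
  simpa [InSh, inclPair] using h

theorem InLine.incl {p : Q × Q} {q : Q} (h : InLine p q) :
    InLine (inclPair p) ((q, 0) : Q × R) := by
  simpa [InLine, inclPair] using h

theorem InCyc.incl {e q : Q} (h : InCyc e q) : InCyc (e, 0) ((q, 0) : Q × R) := by
  simpa [InCyc] using h

/-- The pair obtained from `q` by applying a complete automorphism over a pair in `R`. -/
def twist (f : Q →+ Q) (r s : R) (q : Q) : (Q × R) × (Q × R) := ((q, r), (f q, s))

/-- Bijectivity of the identity, `f` and `id + f` is what makes the twisted triples sweep out all of
`Q` over each of `r`, `s`, `r + s`. -/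
theorem exists_inLine_twist {f : Q →+ Q} (hf : Function.Bijective f)
    (hf' : Function.Bijective (AddMonoidHom.id Q + f)) {r s x : R} (h : InLine (r, s) x) (q : Q) :
    ∃ q₀, InLine (twist f r s q₀) (q, x) := by
  rcases h with rfl | rfl | rfl
  · exact ⟨q, .inl rfl⟩
  · obtain ⟨q₀, rfl⟩ := hf.2 q
    exact ⟨q₀, .inr (.inl rfl)⟩
  · obtain ⟨q₀, rfl⟩ := hf'.2 q
    exact ⟨q₀, .inr (.inr rfl)⟩

theorem InSh.neg {p : Q × Q} {q : Q} (h : InSh p q) : InSh p (-q) := by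
  rcases h with h | h | h | h | h | h <;> simp [InSh, h]

/-- Shrikhande blocks are closed under negation, so after a change of sign only `r`, `s`, `r + s`
have to be treated. -/
theorem exists_inSh_twist {f : Q →+ Q} (hf : Function.Bijective f)
    (hf' : Function.Bijective (AddMonoidHom.id Q + f)) {r s x : R} (h : InSh (r, s) x) (q : Q) :
    ∃ q₀, InSh (twist f r s q₀) (q, x) := by
  have h : InLine (r, s) x ∨ InLine (r, s) (-x) := by
    simp only [InSh, InLine, neg_eq_iff_eq_neg] at h ⊢
    tauto
  rcases h with h | h
  · obtain ⟨q₀, h⟩ := exists_inLine_twist hf hf' h q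
    exact ⟨q₀, h.inSh⟩
  · obtain ⟨q₀, h⟩ := exists_inLine_twist hf hf' h (-q)
    exact ⟨q₀, by simpa using h.inSh.neg⟩

theorem twist_neg (f : Q →+ Q) {r s : R} (hr : -r = r) (hs : -s = s) (q : Q) :
    twist f r s (-q) = -twist f r s q := by
  simp [twist, hr, hs]

theorem two_nsmul_twist (f : Q →+ Q) (r s : R) (q : Q) :
    2 • twist f r s q = twist f (2 • r) (2 • s) (2 • q) := by
  simp [twist]

/-- Over a pair of elements of order two, the twisted pairs of elements killed by two give lines,
and those of representatives up to sign of the other elements give Shrikhande blocks. -/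
theorem exists_block_of_two_nsmul {f : Q →+ Q} (hf : Function.Bijective f)
    (hf' : Function.Bijective (AddMonoidHom.id Q + f)) {r s x : R} (h : InLine (r, s) x)
    (hr : -r = r) (hs : -s = s) {T : List Q} (hT : ∀ q, 2 • q ≠ 0 → q ∈ T ∨ -q ∈ T) (q : Q) :
    (∃ q₀ ∈ T, InSh (twist f r s q₀) (q, x)) ∨
      ∃ q₀, 2 • q₀ = 0 ∧ InLine (twist f r s q₀) (q, x) := by
  obtain ⟨q₀, h⟩ := exists_inLine_twist hf hf' h q
  by_cases hq : 2 • q₀ = 0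
  · exact .inr ⟨q₀, hq, h⟩
  · rcases hT q₀ hq with hq | hq
    · exact .inl ⟨q₀, hq, h.inSh⟩
    · exact .inl ⟨-q₀, hq, by rw [twist_neg f hr hs]; exact h.inSh_neg⟩

end Extension

/-- The old tiling covers `Q × 0`. Over the nonzero part of `ℤ₂²`, a single line, opposite values of
`q` give the same Shrikhande block up to sign, so half of the elements of order four suffice, while
the kernel of doubling gives lines. -/
theorem HasTiling.prod_two {Q : Type*} [AddCommGroup Q] {Γ Δ e : ℕ} (h : HasTiling Q Γ Δ e) :
    HasTiling (Q × ZMod 2 × ZMod 2) (Γ + 2) Δ e := by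
  have := h.finite
  have h4 := h.four_nsmul
  obtain ⟨f, hf, hf'⟩ := h.complete
  obtain ⟨S, L, E, J, hL, hcov, hE, c1, c2, c3⟩ := h.tiling
  obtain ⟨T, hT, hTl⟩ := exists_half Q
  obtain ⟨K, hK, hKl⟩ := exists_list_ker Q
  rw [h.card_ker, h.card] at hTl
  rw [h.card_ker] at hKl
  have p1 : 2 ^ (Γ + 2 + 2 * Δ) = 4 * 2 ^ (Γ + 2 * Δ) := by ring
  have p2 : 2 ^ (Γ + 2 + Δ) = 4 * 2 ^ (Γ + Δ) := by ring
  refine ⟨?_, ?_, ?_, ?_, ?_, S.map inclPair ++ T.map (twist f (1, 0) (0, 1)),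
    L.map inclPair ++ K.map (twist f (1, 0) (0, 1)), E.map fun e => (e, 0), J.map inclPair,
    ?_, ?_, by simpa, ?_, ?_, by simpa⟩
  · have : ∀ r : ZMod 2 × ZMod 2, 4 • r = 0 := by decide
    rintro ⟨q, r⟩
    simp [Prod.smul_mk, h4, this r]
  · simp only [Nat.card_prod, h.card, Nat.card_zmod]
    ring
  · simp only [card_ker_double_prod, card_ker_double_zmod_two, h.card_ker]
    ring
  · simp only [card_range_double_prod, card_range_double_zmod_two, h.card_range]
    ring
  · let g : ZMod 2 × ZMod 2 →+ ZMod 2 × ZMod 2 :=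
      (AddMonoidHom.snd _ _).prod (AddMonoidHom.fst _ _ + AddMonoidHom.snd _ _)
    exact complete_prod (g := g) hf hf' (by decide) (by decide)
  · have two : ∀ r : ZMod 2 × ZMod 2, 2 • r = 0 := by decide
    intro p hp
    rcases List.mem_append.1 hp with hp | hp
    · obtain ⟨p, hp', rfl⟩ := List.mem_map.1 hp
      simp [inclPair, hL p hp']
    · obtain ⟨q, hq, rfl⟩ := List.mem_map.1 hp
      simp only [twist, Prod.smul_mk, two, ← map_nsmul, (hK q).1 hq, map_zero]
      exact ⟨rfl, rfl⟩
  · rintro ⟨q, r⟩ hq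
    by_cases hr : r = 0
    · subst hr
      rcases hcov q (by rintro rfl; exact hq rfl) with
        ⟨p, hp, h⟩ | ⟨p, hp, h⟩ | ⟨p, hp, h⟩ | ⟨p, hp, h⟩
      · exact .inl ⟨_, List.mem_append_left _ (List.mem_map_of_mem hp), h.incl⟩
      · exact .inr (.inl ⟨_, List.mem_append_left _ (List.mem_map_of_mem hp), h.incl⟩)
      · exact .inr (.inr (.inl ⟨_, List.mem_map_of_mem hp, h.incl⟩))
      · refine .inr (.inr (.inr ⟨_, List.mem_map_of_mem hp, h.imp (·.incl) fun h => ?_⟩))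
        have := h.incl (R := ZMod 2 × ZMod 2)
        simpa [inclPair] using this
    · have hr' : ∀ r : ZMod 2 × ZMod 2, r ≠ 0 → InLine ((1, 0), (0, 1)) r := by decide
      rcases exists_block_of_two_nsmul hf hf' (hr' r hr) (by decide) (by decide) hT q with
        ⟨q₀, hq₀, h⟩ | ⟨q₀, hq₀, h⟩
      · exact .inl ⟨_, List.mem_append_right _ (List.mem_map_of_mem hq₀), h⟩
      · exact .inr (.inl ⟨_, List.mem_append_right _ (List.mem_map_of_mem ((hK _).2 hq₀)), h⟩)
  · simp only [List.length_append, List.length_map]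
    omega
  · simp only [List.length_append, List.length_map]
    omega

/-- Over the line of order two in `ℤ₄²`, a twisted line at `2a` is the double of the Shrikhande
block at `a` over `(1, 0), (0, 1)`. Taking one `a` per element of the range of doubling yields `2 ^
Δ` new exchangeable pairs, exactly what keeps `e + 3 * J.length + 1` equal to the order of the
range. -/
theorem HasTiling.prod_four {Q : Type*} [AddCommGroup Q] {Γ Δ e : ℕ} (h : HasTiling Q Γ Δ e) :
    HasTiling (Q × ZMod 4 × ZMod 4) Γ (Δ + 2) e := by
  have := h.finite
  have h4 := h.four_nsmul
  obtain ⟨f, hf, hf'⟩ := h.complete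
  obtain ⟨S, L, E, J, hL, hcov, hE, c1, c2, c3⟩ := h.tiling
  obtain ⟨T, hT, hTl⟩ := exists_half Q
  obtain ⟨A, B, M, hAB, hABl, hAl, hM, hAM, hMl⟩ := exists_lifts h4
  obtain ⟨U, hU, hUl⟩ := exists_list_of_set (Set.univ : Set Q)
  rw [h.card_ker, h.card] at hTl
  rw [h.card] at hABl
  rw [h.card_range] at hAl
  rw [h.card_ker] at hMl
  rw [Set.ncard_univ, h.card] at hUl
  have p1 : 2 ^ (Γ + 2 * (Δ + 2)) = 16 * 2 ^ (Γ + 2 * Δ) := by ring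
  have p2 : 2 ^ (Γ + (Δ + 2)) = 4 * 2 ^ (Γ + Δ) := by ring
  have p3 : 2 ^ (Δ + 2) = 4 * 2 ^ Δ := by ring
  refine ⟨?_, ?_, ?_, ?_, ?_,
    S.map inclPair ++ (T.map (twist f (2, 0) (0, 2)) ++
      (B.map (twist f (1, 0) (0, 1)) ++ U.map (twist f (1, 2) (2, 3)))),
    L.map inclPair ++ M.map (twist f (2, 0) (0, 2)), E.map fun e => (e, 0),
    J.map inclPair ++ A.map (twist f (1, 0) (0, 1)), ?_, ?_, by simpa, ?_, ?_, ?_⟩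
  · have : ∀ r : ZMod 4 × ZMod 4, 4 • r = 0 := by decide
    rintro ⟨q, r⟩
    simp [Prod.smul_mk, h4, this r]
  · simp only [Nat.card_prod, h.card, Nat.card_zmod]
    ring
  · simp only [card_ker_double_prod, card_ker_double_zmod_four, h.card_ker]
    ring
  · simp only [card_range_double_prod, card_range_double_zmod_four, h.card_range]
    ring
  · let g : ZMod 4 × ZMod 4 →+ ZMod 4 × ZMod 4 :=
      (AddMonoidHom.snd _ _).prod (AddMonoidHom.fst _ _ + AddMonoidHom.snd _ _)
    exact complete_prod (g := g) hf hf' (by decide) (by decide)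
  · intro p hp
    rcases List.mem_append.1 hp with hp | hp
    · obtain ⟨p, hp', rfl⟩ := List.mem_map.1 hp
      simp [inclPair, hL p hp']
    · obtain ⟨q, hq, rfl⟩ := List.mem_map.1 hp
      simp only [twist, Prod.smul_mk, ← map_nsmul, hM q hq, map_zero]
      exact ⟨rfl, rfl⟩
  · rintro ⟨q, r⟩ hq
    -- The 15 nonzero elements split into one line and two Shrikhande blocks.
    have hr' : ∀ r : ZMod 4 × ZMod 4, r = 0 ∨ InLine ((2, 0), (0, 2)) r ∨
      InSh ((1, 0), (0, 1)) r ∨ InSh ((1, 2), (2, 3)) r := by decide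
    rcases hr' r with rfl | hr | hr | hr
    · rcases hcov q (by rintro rfl; exact hq rfl) with
        ⟨p, hp, h⟩ | ⟨p, hp, h⟩ | ⟨p, hp, h⟩ | ⟨p, hp, h⟩
      · exact .inl ⟨_, List.mem_append_left _ (List.mem_map_of_mem hp), h.incl⟩
      · exact .inr (.inl ⟨_, List.mem_append_left _ (List.mem_map_of_mem hp), h.incl⟩)
      · exact .inr (.inr (.inl ⟨_, List.mem_map_of_mem hp, h.incl⟩))
      · refine .inr (.inr (.inr ⟨_, List.mem_append_left _ (List.mem_map_of_mem hp),
          h.imp (·.incl) fun h => ?_⟩))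
        have := h.incl (R := ZMod 4 × ZMod 4)
        simpa [inclPair] using this
    · rcases exists_block_of_two_nsmul hf hf' hr (by decide) (by decide) hT q with
        ⟨q₀, hq₀, h⟩ | ⟨q₀, hq₀, h⟩
      · exact .inl ⟨_, List.mem_append_right _
          (List.mem_append_left _ (List.mem_map_of_mem hq₀)), h⟩
      · rcases hAM q₀ hq₀ with hq₀ | ⟨a, ha, rfl⟩
        · exact .inr (.inl ⟨_, List.mem_append_right _ (List.mem_map_of_mem hq₀), h⟩)
        · refine .inr (.inr (.inr ⟨_, List.mem_append_right _ (List.mem_map_of_mem ha), .inr ?_⟩))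
          rw [two_nsmul_twist]
          exact h
    · obtain ⟨q₀, h⟩ := exists_inSh_twist hf hf' hr q
      rcases hAB q₀ with hq₀ | hq₀
      · exact .inr (.inr (.inr ⟨_, List.mem_append_right _ (List.mem_map_of_mem hq₀), .inl h⟩))
      · exact .inl ⟨_, List.mem_append_right _ (List.mem_append_right _
          (List.mem_append_left _ (List.mem_map_of_mem hq₀))), h⟩
    · obtain ⟨q₀, h⟩ := exists_inSh_twist hf hf' hr q
      exact .inl ⟨_, List.mem_append_right _ (List.mem_append_right _
        (List.mem_append_right _ (List.mem_map_of_mem ((hU _).2 trivial)))), h⟩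
  all_goals
    simp only [List.length_append, List.length_map]
    omega

/-! ### Base tilings and the choice of parameters -/

theorem hasTiling_punit : HasTiling PUnit 0 0 0 where
  four_nsmul _ := rfl
  card := by simp
  card_ker := by simp
  card_range := by simp
  complete := ⟨0, by simp [Function.Bijective, Function.Injective, Function.Surjective]⟩
  tiling := ⟨[], [], [], [], by simp⟩

-- The base case for odd `Δ`: `ℤ₄` itself would need the forbidden single cyclic block, so the
-- induction starts at `Δ = 3` with four. The complete automorphism satisfies `t³ = t + 1`, and `t³
-- - t - 1` is a unit at both 0 and -1.
set_option maxRecDepth 4000 in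
theorem hasTiling_zmod_four_cube : HasTiling (ZMod 4 × ZMod 4 × ZMod 4) 0 3 4 where
  four_nsmul := by decide
  card := by simp
  card_ker := by simp only [card_ker_double_prod, card_ker_double_zmod_four]; norm_num
  card_range := by simp only [card_range_double_prod, card_range_double_zmod_four]; norm_num
  complete := by
    let x := AddMonoidHom.fst (ZMod 4) (ZMod 4 × ZMod 4)
    let y := (AddMonoidHom.fst (ZMod 4) (ZMod 4)).comp (AddMonoidHom.snd (ZMod 4) _)
    let z := (AddMonoidHom.snd (ZMod 4) (ZMod 4)).comp (AddMonoidHom.snd (ZMod 4) _)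
    refine ⟨z.prod ((x + z).prod y), ?_, ?_⟩
    all_goals
      rw [← Finite.injective_iff_bijective, injective_iff_map_eq_zero]
      decide
  tiling := ⟨[((0, 1, 2), (2, 0, 3)), ((0, 1, 3), (1, 1, 2)), ((0, 2, 1), (1, 0, 3)),
      ((1, 0, 2), (1, 3, 3)), ((1, 1, 3), (1, 2, 3)), ((1, 2, 2), (1, 3, 2)),
      ((1, 3, 0), (1, 3, 1))], [], [(0, 0, 1), (0, 1, 1), (1, 0, 1), (1, 1, 1)],
      [((1, 0, 0), (0, 1, 0))], by simp, by decide, by simp⟩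

theorem HasTiling.exists_add_two_mul {Q : Type} [AddCommGroup Q] {Δ e : ℕ}
    (h : HasTiling Q 0 Δ e) (γ δ : ℕ) :
    ∃ (R : Type) (_ : AddCommGroup R), HasTiling R (2 * γ) (Δ + 2 * δ) e := by
  induction γ with
  | zero =>
    induction δ with
    | zero => exact ⟨Q, inferInstance, h⟩
    | succ δ ih =>
      obtain ⟨R, _, hR⟩ := ih
      exact ⟨_, inferInstance, hR.prod_four⟩
  | succ γ ih =>
    obtain ⟨R, _, hR⟩ := ih
    exact ⟨_, inferInstance, hR.prod_two⟩

theorem two_pow_mod_three (k : ℕ) : 2 ^ k % 3 = 1 + k % 2 := by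
  induction k with
  | zero => rfl
  | succ k ih => rcases Nat.mod_two_eq_zero_or_one k with h | h <;> rw [pow_succ] <;> omega

theorem exists_code_of_parameters {m n' n'' Γ Δ : ℕ}
    (h1 : 2 ^ (Γ + 2 * Δ) = 6 * m + 3 * n' + 3 * n'' + 1)
    (h2 : 2 ^ (Γ + Δ) = 3 * n' + n'' + 1) (h3 : n'' + 1 ≤ 2 ^ Δ) (hne : n'' ≠ 1) :
    ∃ C : AddSubgroup (Space m n' n''),
      IsOnePerfect (graph m n' n'') (C : Set (Space m n' n'')) := by
  have e1 := two_pow_mod_three (Γ + 2 * Δ)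
  have e2 := two_pow_mod_three (Γ + Δ)
  -- By `h1`, `2 ^ (Γ + 2 * Δ)` is 1 modulo 3, so `Γ` is even; by `h2`, `n''` is then 0 or 1 modulo
  -- 3 according to the parity of `Δ`.
  obtain ⟨γ, rfl⟩ : ∃ γ, Γ = 2 * γ := ⟨Γ / 2, by omega⟩
  have key : ∃ e t : ℕ, n'' = e + 3 * t ∧
      ∃ (Q : Type) (_ : AddCommGroup Q), HasTiling Q (2 * γ) Δ e := by
    rcases Nat.even_or_odd' Δ with ⟨δ, rfl | rfl⟩
    · refine ⟨0, n'' / 3, by omega, ?_⟩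
      simpa using hasTiling_punit.exists_add_two_mul γ δ
    · rcases δ with _ | δ
      -- For `Δ = 1` the bound leaves only `n'' ≤ 1`, and the residue makes it the excluded value 1.
      · norm_num at h3
        omega
      · refine ⟨4, (n'' - 4) / 3, by omega, ?_⟩
        rw [show 2 * (δ + 1) + 1 = 3 + 2 * δ by ring]
        exact hasTiling_zmod_four_cube.exists_add_two_mul γ δ
  obtain ⟨e, t, rfl, Q, _, hQ⟩ := key
  exact exists_code_of_hasTiling hQ h1.symm h2.symm h3

end Doob

theorem theorem3p2 (m n' n'' : ℕ) (hne : (m, n', n'') ≠ (0, 0, 1)) :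
    (∃ C : AddSubgroup (Doob.Space m n' n''),
      Doob.IsOnePerfect (Doob.graph m n' n'') (C : Set (Doob.Space m n' n''))) ↔
    ∃ Γ Δ : ℕ,
      2 * (m : ℚ) + n' + n'' = (2 ^ (Γ + 2 * Δ) - 1) / 3 ∧
      3 * (n' : ℚ) + n'' = 2 ^ (Γ + Δ) - 1 ∧
      (n'' : ℚ) ≤ 2 ^ Δ - 1 ∧
      n'' ≠ 1 := by
  constructor
  · rintro ⟨C, hC⟩
    obtain ⟨Γ, Δ, h1, h2, h3, h4⟩ := Doob.exists_parameters_of_code hne C hC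
    have h1 : (2 : ℚ) ^ (Γ + 2 * Δ) = 6 * m + 3 * n' + 3 * n'' + 1 := by exact_mod_cast h1
    have h2 : (2 : ℚ) ^ (Γ + Δ) = 3 * n' + n'' + 1 := by exact_mod_cast h2
    have h3 : (n'' : ℚ) + 1 ≤ 2 ^ Δ := by exact_mod_cast h3
    exact ⟨Γ, Δ, by linarith, by linarith, by linarith, h4⟩
  · rintro ⟨Γ, Δ, h1, h2, h3, h4⟩
    have h1 : (2 : ℚ) ^ (Γ + 2 * Δ) = 6 * m + 3 * n' + 3 * n'' + 1 := by linarith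
    have h2 : (2 : ℚ) ^ (Γ + Δ) = 3 * n' + n'' + 1 := by linarith
    have h3 : (n'' : ℚ) + 1 ≤ 2 ^ Δ := by linarith
    exact Doob.exists_code_of_parameters (by exact_mod_cast h1) (by exact_mod_cast h2)
      (by exact_mod_cast h3) h4
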